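/- Let $G$ be a finite directed graph (loops allowed, no multiple edges) with vertex set $V$ and $m\ge 1$ edges that is Eulerian: strongly connected, with in-degree equal to out-degree at every vertex; write $\deg(x)$ for this common degree. Let $\mathsf P$ be the simple random walk, $\mathsf P(x,y)=1/\deg(x)$ if there is an edge from $x$ to $y$ and $\mathsf P(x,y)=0$ otherwise, and let $\mathsf L=\frac12(I+\mathsf P)$ be the lazy simple random walk. Put $\pi(x)=\deg(x)/m$. For a kernel $\mathsf K$ on $V$ (either $\mathsf P$ or $\mathsf L$) and $A,B\subset V$ let $\mathsf Q(A,B)=\sum_{x\in A,\,y\in B}\pi(x)\mathsf K(x,y)$, let $N(A)=\{x\in V:\mathsf Q(A,\{x\})>0\}$, and let $$\Psi(A)=\min_{\substack{B\subset V,\,v\in V\\ \pi(B)\le \pi(A^c)<\pi(B\cup\{v\})}}\ \mathsf Q(A,B)+\bigl(\pi(A^c)-\pi(B)\bigr)\frac{\mathsf Q(A,\{v\})}{\pi(v)}\qquad(A\neq\emptyset).$$ Let $\tau_2(\epsilon)$ be the least $n\ge 0$ such that for every $x\in V$ $$\Bigl(\sum_{y\in V}\pi(y)\Bigl|\frac{\mathsf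 K^n(x,y)}{\pi(y)}-1\Bigr|^2\Bigr)^{1/2}\le\epsilon$$ (and $\tau_2(\epsilon)=\infty$ if there is no such $n$). Then $\pi$ is a stationary distribution of both $\mathsf P$ and $\mathsf L$, and the following hold. 1. (Simple walk, $\mathsf K=\mathsf P$.) Suppose that $\pi(N(A)\setminus\{v\})\ge\pi(A)$ for all $A\subset V$ with $\pi(A)\le 1/2$ and all $v\in V$. Then $\Psi(A)\ge \frac1m$ for every non-empty $A\subset V$ with $\pi(A)\le 1/2$, and for every $0<\epsilon\le 1$ $$\tau_2(\epsilon)\le\left\lceil \frac{m^2}{12}+\frac{m^2}{8}\log\frac1\epsilon\right\rceil .$$ 2. (Lazy walk, $\mathsf K=\mathsf L$, with no expansion condition.) $\Psi(A)\ge\frac1{2m}$ for every $A\subset V$ with $A\ne\emptyset,V$, and for every $0<\epsilon\le1$ $$\tau_2(\epsilon)\le\left\lceil \frac{m^2}{3}+\frac{m^2}{2}\log\frac1\epsilon\right\rceil .$$ -/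

import Mathlib

open Finset

namespace MarkovMixing

noncomputable section

/-- The measure `π(A)` of a set of states. -/
def mass {V : Type*} (π : V → ℝ) (A : Finset V) : ℝ := ∑ x ∈ A, π x

/-- The ergodic flow `Q(A, B) = ∑_{x ∈ A, y ∈ B} π(x) P(x, y)`. -/
def flow {V : Type*} (P : Matrix V V ℝ) (π : V → ℝ) (A B : Finset V) : ℝ :=
  ∑ x ∈ A, ∑ y ∈ B, π x * P x y

/-- `π` is a probability distribution on `V` with `π P = π`. -/
def IsStationary {V : Type*} [Fintype V] (P : Matrix V V ℝ) (π : V → ℝ) : Prop :=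
  (∀ x, 0 ≤ π x) ∧ ∑ x, π x = 1 ∧ Matrix.vecMul π P = π

/-- The values `Q(A, B) + (t - π(B)) Q(A, v) / π(v)`, where `B` is a set of states and `v` is a
state with `π(B) ≤ t < π(B ∪ {v})`. -/
def flowValues {V : Type*} [DecidableEq V] (P : Matrix V V ℝ) (π : V → ℝ)
    (A : Finset V) (t : ℝ) : Set ℝ :=
  {q | ∃ (B : Finset V) (v : V), mass π B ≤ t ∧ t < mass π (insert v B) ∧
    q = flow P π A B + (t - mass π B) * (flow P π A {v} / π v)}

/-- `Ψ(A, t)`, the smallest flow from `A` into a set of size `t`. The set of values is finite, and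
it is non-empty for `0 ≤ t < 1`, so the infimum is then a minimum. -/
def minFlow {V : Type*} [DecidableEq V] (P : Matrix V V ℝ) (π : V → ℝ)
    (A : Finset V) (t : ℝ) : ℝ :=
  sInf (flowValues P π A t)

/-- `Ψ(A) = Ψ(A, π(Aᶜ))`. -/
def modifiedFlow {V : Type*} [Fintype V] [DecidableEq V] (P : Matrix V V ℝ) (π : V → ℝ)
    (A : Finset V) : ℝ :=
  minFlow P π A (mass π Aᶜ)

/-- The neighbourhood `N(A) = {x | Q(A, x) > 0}`. -/
def neighborhood {V : Type*} [Fintype V] (P : Matrix V V ℝ) (π : V → ℝ)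
    (A : Finset V) : Finset V :=
  univ.filter fun x => 0 < flow P π A {x}

/-- The weak expansion condition: `π(N(A) \ {v}) ≥ π(A)` for every `A` with `π(A) ≤ 1/2` and
every `v`. -/
def WeakExpansion {V : Type*} [Fintype V] [DecidableEq V] (P : Matrix V V ℝ)
    (π : V → ℝ) : Prop :=
  ∀ A : Finset V, mass π A ≤ 1 / 2 →
    ∀ v : V, mass π A ≤ mass π (neighborhood P π A \ {v})

/-- The distance `‖μ/π - 1‖_{2,π}`. -/
def l2Dist {V : Type*} [Fintype V] (μ π : V → ℝ) : ℝ :=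
  Real.sqrt (∑ x, π x * (μ x / π x - 1) ^ 2)

/-- The `L²` mixing time `τ₂(ε)`: the least `n` such that `‖Pⁿ(x, ·)/π - 1‖_{2,π} ≤ ε` for every
starting state `x`. It is `⊤` when there is no such `n`. -/
def l2MixingTime {V : Type*} [Fintype V] [DecidableEq V] (P : Matrix V V ℝ) (π : V → ℝ)
    (ε : ℝ) : ℕ∞ :=
  ⨅ (n : ℕ) (_ : ∀ x, l2Dist ((P ^ n) x) π ≤ ε), (n : ℕ∞)

open Classical in
/-- Out-degree of a vertex (a loop counts once). -/
def outDeg {V : Type*} [Fintype V] (G : Digraph V) (x : V) : ℕ :=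
  (univ.filter fun y => G.Adj x y).card

open Classical in
/-- In-degree of a vertex (a loop counts once). -/
def inDeg {V : Type*} [Fintype V] (G : Digraph V) (x : V) : ℕ :=
  (univ.filter fun y => G.Adj y x).card

open Classical in
/-- Number of directed edges. -/
def numEdges {V : Type*} [Fintype V] (G : Digraph V) : ℕ :=
  (univ.filter fun p : V × V => G.Adj p.1 p.2).card

/-- A directed Eulerian graph: strongly connected, with equal in- and out-degree at each
vertex. -/
structure IsEulerian {V : Type*} [Fintype V] (G : Digraph V) : Prop where
  stronglyConnected : ∀ x y, Relation.ReflTransGen G.Adj x y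
  inDeg_eq_outDeg : ∀ x, inDeg G x = outDeg G x

open Classical in
/-- Transition matrix of the simple random walk. -/
def simpleWalk {V : Type*} [Fintype V] (G : Digraph V) : Matrix V V ℝ :=
  fun x y => if G.Adj x y then 1 / (outDeg G x : ℝ) else 0

/-- Transition matrix of the lazy simple random walk: with probability `1/2` stay, otherwise make
a step of the simple random walk. -/
def lazyWalk {V : Type*} [Fintype V] [DecidableEq V] (G : Digraph V) : Matrix V V ℝ :=
  (1 / 2 : ℝ) • (1 + simpleWalk G)

/-- The distribution `π(x) = deg(x) / m`. -/
def degDist {V : Type*} [Fintype V] (G : Digraph V) : V → ℝ :=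
  fun x => (outDeg G x : ℝ) / (numEdges G : ℝ)

end

end MarkovMixing

/-!
The proof follows the evolving set process. From a set `A` it moves to `{y | u ≤ Q(A, y) / π(y)}`
with `u` uniform in `(0, 1]`, and it is dual to the walk: started at `{x}`,
`π(x) Pⁿ(x, y) = π(y) ℙ(y ∈ Sₙ)` (`sum_evolvingKernel_pow_mem`). Thus `Pⁿ(x, ·) / π - 1` is the mean
of the centred indicators of `Sₙ`, divided by `π(x)`, and Minkowski's inequality bounds its norm by
`lₙ = 𝔼 √(a (1 - a)) / π(x)` with `a = π(Sₙ)` (`l2Dist_le_sum_evolvingKernel`).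

The size of the evolving set is a martingale, and its mean absolute change in one step from `A` is
at least `2 Ψ(A)`, and at least `2 Ψ(Aᶜ)` (`two_mul_modifiedFlow_le`): fill `B` with the vertices
of smallest density `Q(A, y) / π(y)` and compare with the levels below the threshold that is
reached. The inequality between Hellinger affinity and total variation turns a bound `Ψ ≥ c` into
the contraction of `√(a (1 - a))` by the factor `1 - c² / (2 a² (1 - a)²)` (`sum_sqrt_le_sub`).
Written in terms of `z = √((1 - a) / a)`, the loss is at least the convex function
`(c² / 2) decayRate z`, and averaging supporting lines with respect to the weights `a / π(x)` gives
`lₙ₊₁ ≤ lₙ - (c² / 2) decayRate lₙ` (`evolvingKernel_decay`). The time to come down from infinity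
to `1` is then at most `1 / (12 c²)`, and from `1` to `ε` it is at most `log (1 / ε) / (8 c²)`
(`le_of_decayRate`).

It remains to bound `Ψ` for the two walks, where each edge carries flow `1 / m` and all sizes are
multiples of `1 / m`. Under weak expansion `N(A) \ {v}` is too large to avoid `B`, so that an edge
leads from `A` to `B` (`le_modifiedFlow_simpleWalk`). The lazy walk loses a factor `2` and needs
only strong connectivity (`le_modifiedFlow_lazyWalk`).
-/

namespace MarkovMixing

/-! ### The decay rate and its tangent lines -/

/-- The decay rate `(1 + z²)⁴ / z³` of the `L²` functional along evolving sets, in the variable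
`z = √((1 - a) / a)` where `a` is the size of the current set. On `[0, 1]` it is replaced by the
tangent `16 z` at `1`, which makes it convex and increasing on `[0, ∞)`, and zero at `0`. -/
noncomputable def decayRate (z : ℝ) : ℝ := if z ≤ 1 then 16 * z else (1 + z ^ 2) ^ 4 / z ^ 3

theorem decayRate_nonneg {z : ℝ} (hz : 0 ≤ z) : 0 ≤ decayRate z := by
  unfold decayRate
  split_ifs <;> positivity

/-- Convexity of `z ↦ z⁻³` and `z ↦ z⁻¹` on `(0, ∞)`, as tangent line inequalities. -/
theorem inv_tangent_le {z l : ℝ} (hz : 0 < z) (hl : 0 < l) :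
    2 / l - z / l ^ 2 ≤ 1 / z ∧ 4 / l ^ 3 - 3 * z / l ^ 4 ≤ 1 / z ^ 3 := by
  constructor
  · have h : 1 / z - (2 / l - z / l ^ 2) = (z - l) ^ 2 / (z * l ^ 2) := by field_simp; ring
    have : 0 ≤ (z - l) ^ 2 / (z * l ^ 2) := by positivity
    linarith
  · have h : 1 / z ^ 3 - (4 / l ^ 3 - 3 * z / l ^ 4)
        = (z - l) ^ 2 * (3 * z ^ 2 + 2 * z * l + l ^ 2) / (z ^ 3 * l ^ 4) := by field_simp; ring
    have : 0 ≤ (z - l) ^ 2 * (3 * z ^ 2 + 2 * z * l + l ^ 2) / (z ^ 3 * l ^ 4) := by positivity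
    linarith

/-- Supporting lines of the decay rate. They lie below `(1 + z²)⁴ / z³` on all of `(0, ∞)` and are
non-positive at `0`; this replaces convexity in the application of Jensen's inequality. -/
theorem exists_decayRate_tangent (l : ℝ) :
    ∃ α β : ℝ, α ≤ 0 ∧ (∀ z : ℝ, 0 < z → α + β * z ≤ (1 + z ^ 2) ^ 4 / z ^ 3) ∧
      α + β * l = decayRate l := by
  unfold decayRate
  split_ifs with h1
  · refine ⟨0, 16, le_rfl, fun z hz => ?_, by ring⟩
    rw [le_div_iff₀ (by positivity)]
    have h : (2 * z) ^ 4 ≤ (1 + z ^ 2) ^ 4 :=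
      pow_le_pow_left₀ (by positivity) (by nlinarith [sq_nonneg (z - 1)]) 4
    nlinarith
  · have h1 : 1 < l := not_le.mp h1
    have l0 : 0 < l := by linarith
    -- the tangent at `l` of `z⁻³ + 4 z⁻¹ + 6 z + 4 z³ + z⁵`
    refine ⟨4 / l ^ 3 + 8 / l - 8 * l ^ 3 - 4 * l ^ 5,
      -3 / l ^ 4 - 4 / l ^ 2 + 6 + 12 * l ^ 2 + 5 * l ^ 4, ?_, fun z hz => ?_, ?_⟩
    · have e1 : 4 / l ^ 3 ≤ 4 := div_le_self (by norm_num) (one_le_pow₀ h1.le)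
      have e2 : 8 / l ≤ 8 := div_le_self (by norm_num) h1.le
      have e3 : 1 ≤ l ^ 3 := one_le_pow₀ h1.le
      have e4 : 1 ≤ l ^ 5 := one_le_pow₀ h1.le
      linarith
    · have e : (1 + z ^ 2) ^ 4 / z ^ 3 = 1 / z ^ 3 + 4 * (1 / z) + 6 * z + 4 * z ^ 3 + z ^ 5 := by
        field_simp; ring
      obtain ⟨i1, i3⟩ := inv_tangent_le hz l0
      have p3 : 0 ≤ (z - l) ^ 2 * (z + 2 * l) := by positivity
      have p5 : 0 ≤ (z - l) ^ 2 * (z ^ 3 + 2 * l * z ^ 2 + 3 * l ^ 2 * z + 4 * l ^ 3) := by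
        positivity
      have e' : 4 / l ^ 3 + 8 / l - 8 * l ^ 3 - 4 * l ^ 5
          + (-3 / l ^ 4 - 4 / l ^ 2 + 6 + 12 * l ^ 2 + 5 * l ^ 4) * z
          = (4 / l ^ 3 - 3 * z / l ^ 4) + 4 * (2 / l - z / l ^ 2) + 6 * z
            + 4 * (3 * l ^ 2 * z - 2 * l ^ 3) + (5 * l ^ 4 * z - 4 * l ^ 5) := by ring
      rw [e, e']
      nlinarith
    · field_simp
      ring

/-! ### Decay of sequences with the given rate -/

/-- The antiderivative of `2 / decayRate` on `(0, ∞)` that vanishes at `1`. It decreases at constant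
speed `κ` along solutions of `l' = -(κ / 2) decayRate l`, and it is bounded above. -/
noncomputable def decayPotential (l : ℝ) : ℝ :=
  if l ≤ 1 then Real.log l / 8
  else 1 / 12 - (1 / (2 * (1 + l ^ 2) ^ 2) - 1 / (3 * (1 + l ^ 2) ^ 3))

theorem decayPotential_lt (l : ℝ) (hl : 0 < l) : decayPotential l < 1 / 12 := by
  unfold decayPotential
  split_ifs with h
  · have := Real.log_nonpos hl.le h
    linarith
  · have : 1 / (3 * (1 + l ^ 2) ^ 3) < 1 / (2 * (1 + l ^ 2) ^ 2) := by
      apply one_div_lt_one_div_of_lt (by positivity)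
      nlinarith [pow_pos (show 0 < 1 + l ^ 2 by positivity) 2, sq_nonneg l,
        mul_nonneg (sq_nonneg l) (sq_nonneg (1 + l ^ 2))]
    linarith

/-- On `[1, ∞)` the potential lies below its tangents, its derivative `2 l³ / (1 + l²)⁴` being
antitone there. -/
theorem rational_potential_tangent {l l' : ℝ} (h1 : 1 ≤ l') (h : l' ≤ l) :
    2 * l ^ 3 / (1 + l ^ 2) ^ 4 * (l - l') ≤
      (1 / (2 * (1 + l' ^ 2) ^ 2) - 1 / (3 * (1 + l' ^ 2) ^ 3))
        - (1 / (2 * (1 + l ^ 2) ^ 2) - 1 / (3 * (1 + l ^ 2) ^ 3)) := by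
  have hd : ∀ t : ℝ, HasDerivAt
      (fun t : ℝ => -(1 / (2 * (1 + t ^ 2) ^ 2) - 1 / (3 * (1 + t ^ 2) ^ 3)))
      (2 * t ^ 3 / (1 + t ^ 2) ^ 4) t := by
    intro t
    have p : (1 + t ^ 2) ≠ 0 := by positivity
    have b : HasDerivAt (fun t : ℝ => 1 + t ^ 2) (2 * t) t := by
      simpa using (hasDerivAt_pow 2 t).const_add 1
    have h2 := ((b.fun_pow 2).const_mul 2).fun_inv (by positivity)
    have h3 := ((b.fun_pow 3).const_mul 3).fun_inv (by positivity)
    have h4 := (h2.fun_sub h3).fun_neg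
    simp only [one_div]
    refine h4.congr_deriv ?_
    field_simp
    push_cast
    ring
  have anti : ∀ t, 1 ≤ t → t ≤ l → 2 * l ^ 3 / (1 + l ^ 2) ^ 4 ≤ 2 * t ^ 3 / (1 + t ^ 2) ^ 4 := by
    intro t ht htl
    have l0 : 0 < l := by linarith
    have k1 : l / (1 + l ^ 2) ≤ t / (1 + t ^ 2) := by
      rw [div_le_div_iff₀ (by positivity) (by positivity)]
      have : 0 ≤ (l - t) * (l * t - 1) := mul_nonneg (by linarith) (by nlinarith)
      nlinarith
    have k2 : 1 / (1 + l ^ 2) ≤ 1 / (1 + t ^ 2) :=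
      one_div_le_one_div_of_le (by positivity) (by nlinarith)
    have k3 : (l / (1 + l ^ 2)) ^ 3 * (1 / (1 + l ^ 2)) ≤
        (t / (1 + t ^ 2)) ^ 3 * (1 / (1 + t ^ 2)) :=
      mul_le_mul (pow_le_pow_left₀ (by positivity) k1 3) k2 (by positivity) (by positivity)
    have e : ∀ s : ℝ, 2 * s ^ 3 / (1 + s ^ 2) ^ 4
        = 2 * ((s / (1 + s ^ 2)) ^ 3 * (1 / (1 + s ^ 2))) := by
      intro s
      have : (1 + s ^ 2) ≠ 0 := by positivity
      field_simp
    rw [e, e]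
    linarith
  have key := (convex_Icc l' l).mul_sub_le_image_sub_of_le_deriv
    (f := fun t : ℝ => -(1 / (2 * (1 + t ^ 2) ^ 2) - 1 / (3 * (1 + t ^ 2) ^ 3)))
    (fun t _ => (hd t).continuousAt.continuousWithinAt)
    (fun t _ => (hd t).differentiableAt.differentiableWithinAt)
    (C := 2 * l ^ 3 / (1 + l ^ 2) ^ 4)
    (fun t ht => by
      rw [interior_Icc] at ht
      rw [(hd t).deriv]
      exact anti t (h1.trans ht.1.le) ht.2.le)
    l' (Set.left_mem_Icc.2 h) l (Set.right_mem_Icc.2 h) h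
  linarith

/-- One step of size `(κ / 2) decayRate l` lowers the potential by at least `κ`. -/
theorem decayPotential_step {κ l l' : ℝ} (hl' : 0 < l')
    (h : l' ≤ l - κ / 2 * decayRate l) (hle : l' ≤ l) :
    decayPotential l' ≤ decayPotential l - κ := by
  have l0 : 0 < l := by linarith
  unfold decayRate at h
  unfold decayPotential
  by_cases hl1 : l ≤ 1
  · rw [if_pos hl1] at h
    rw [if_pos hl1, if_pos (hle.trans hl1)]
    have e : Real.log (l' / l) ≤ l' / l - 1 := Real.log_le_sub_one_of_pos (by positivity)
    rw [Real.log_div hl'.ne' l0.ne'] at e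
    have : l' / l ≤ 1 - 8 * κ := by
      rw [div_le_iff₀ l0]
      linarith
    linarith
  · rw [if_neg hl1] at h
    rw [if_neg hl1]
    have hl1 : 1 ≤ l := (not_le.mp hl1).le
    have hs : κ ≤ 2 * l ^ 3 / (1 + l ^ 2) ^ 4 * (l - l') := by
      have e : 2 * l ^ 3 / (1 + l ^ 2) ^ 4 * (κ / 2 * ((1 + l ^ 2) ^ 4 / l ^ 3)) = κ := by
        have : (1 + l ^ 2) ≠ 0 := by positivity
        field_simp
      calc κ = _ := e.symm
        _ ≤ _ := mul_le_mul_of_nonneg_left (by linarith) (by positivity)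
    split_ifs with hl'1
    · have t := rational_potential_tangent le_rfl hl1
      have e := Real.log_le_sub_one_of_pos hl'
      have s8 : 2 * l ^ 3 / (1 + l ^ 2) ^ 4 ≤ 1 / 8 := by
        rw [div_le_iff₀ (by positivity)]
        have q : (2 * l) ^ 4 ≤ (1 + l ^ 2) ^ 4 :=
          pow_le_pow_left₀ (by positivity) (by nlinarith [sq_nonneg (l - 1)]) 4
        have : l ^ 3 ≤ l ^ 4 := pow_le_pow_right₀ hl1 (by norm_num)
        nlinarith
      have m8 : 2 * l ^ 3 / (1 + l ^ 2) ^ 4 * (1 - l') ≤ 1 / 8 * (1 - l') :=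
        mul_le_mul_of_nonneg_right s8 (by linarith)
      norm_num at t e ⊢
      nlinarith
    · have t := rational_potential_tangent (not_le.mp hl'1).le hle
      linarith

/-- A non-negative sequence that decays by `(κ / 2) decayRate` in each step is at most `ε` after
`κ⁻¹ (1 / 12 + log (1 / ε) / 8)` steps, whatever its initial value. -/
theorem le_of_decayRate {κ : ℝ} (hκ : 0 < κ) {l : ℕ → ℝ} (h0 : ∀ n, 0 ≤ l n)
    (hl : ∀ n, l (n + 1) ≤ l n - κ / 2 * decayRate (l n)) {ε : ℝ} (hε : 0 < ε) (hε1 : ε ≤ 1)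
    {N : ℕ} (hN : (1 / 12 + Real.log (1 / ε) / 8) / κ ≤ N) : l N ≤ ε := by
  by_contra! hc
  have hstep : ∀ n, l (n + 1) ≤ l n := fun n => by
    have := mul_nonneg (half_pos hκ).le (decayRate_nonneg (h0 n))
    linarith [hl n]
  have hanti : Antitone l := antitone_nat_of_succ_le hstep
  have hpos : ∀ n, n ≤ N → 0 < l n := fun n hn => hε.trans (hc.trans_le (hanti hn))
  have hpot : ∀ n, n ≤ N → decayPotential (l n) ≤ decayPotential (l 0) - n * κ := by
    intro n
    induction n with
    | zero => intro _; simp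
    | succ k ih =>
      intro hk
      have := decayPotential_step (hpos _ hk) (hl k) (hstep k)
      have := ih (by omega)
      push_cast
      linarith
  have h1 := hpot N le_rfl
  have h2 := decayPotential_lt (l 0) (hpos 0 (Nat.zero_le _))
  have h3 : -(Real.log (1 / ε) / 8) ≤ decayPotential (l N) := by
    rw [one_div, Real.log_inv]
    unfold decayPotential
    split_ifs with h
    · have := Real.log_le_log hε hc.le
      linarith
    · have t := rational_potential_tangent le_rfl (not_le.mp h).le
      have p : 0 ≤ 2 * l N ^ 3 / (1 + l N ^ 2) ^ 4 * (l N - 1) :=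
        mul_nonneg (by have := h0 N; positivity) (by linarith [not_le.mp h])
      have := Real.log_nonpos hε.le hε1
      norm_num at t ⊢
      linarith
  rw [div_le_iff₀ hκ] at hN
  linarith

/-! ### Hellinger affinity and total variation -/

variable {ι : Type*} [Fintype ι]

/-- The affinity of the densities `X / a` and `(1 - X) / (1 - a)` is at most `1`. -/
theorem sum_sqrt_le {k X : ι → ℝ} {a : ℝ} (hk : ∀ i, 0 ≤ k i) (hk1 : ∑ i, k i = 1)
    (hX0 : ∀ i, 0 ≤ X i) (hX1 : ∀ i, X i ≤ 1) (ha : ∑ i, k i * X i = a) :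
    ∑ i, k i * √(X i * (1 - X i)) ≤ √(a * (1 - a)) := by
  have hb : ∑ i, k i * (1 - X i) = 1 - a := by
    simp only [mul_sub, mul_one, sum_sub_distrib, hk1, ha]
  have h1 : ∀ i, 0 ≤ k i * X i := fun i => mul_nonneg (hk i) (hX0 i)
  have h2 : ∀ i, 0 ≤ k i * (1 - X i) := fun i => mul_nonneg (hk i) (sub_nonneg.2 (hX1 i))
  have h := Real.sum_sqrt_mul_sqrt_le univ h1 h2
  rw [ha, hb, ← Real.sqrt_mul (by rw [← ha]; exact sum_nonneg fun i _ => h1 i)] at h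
  convert h using 2 with i
  rw [← Real.sqrt_mul (h1 i),
    show k i * X i * (k i * (1 - X i)) = k i ^ 2 * (X i * (1 - X i)) by ring,
    Real.sqrt_mul (sq_nonneg _), Real.sqrt_sq (hk i)]

/-- The inequality between Hellinger affinity and total variation, for the densities `X / a` and
`(1 - X) / (1 - a)`. -/
theorem sum_sqrt_le_sub {k X : ι → ℝ} {a c : ℝ} (hk : ∀ i, 0 ≤ k i) (hk1 : ∑ i, k i = 1)
    (hX0 : ∀ i, 0 ≤ X i) (hX1 : ∀ i, X i ≤ 1) (ha : ∑ i, k i * X i = a) (ha0 : 0 < a) (ha1 : a < 1)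
    (hc0 : 0 ≤ c) (hc : 2 * c ≤ ∑ i, k i * |X i - a|) :
    ∑ i, k i * √(X i * (1 - X i)) ≤ √(a * (1 - a)) - c ^ 2 / (2 * √(a * (1 - a)) ^ 3) := by
  have hb : ∑ i, k i * (1 - X i) = 1 - a := by
    simp only [mul_sub, mul_one, sum_sub_distrib, hk1, ha]
  have hq : 0 < a * (1 - a) := mul_pos ha0 (by linarith)
  set F := √(a * (1 - a)) with hF
  have hF0 : 0 < F := Real.sqrt_pos.2 hq
  have hF2 : F ^ 2 = a * (1 - a) := Real.sq_sqrt hq.le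
  set H := ∑ i, k i * √(X i * (1 - X i)) with hH
  set S : ι → ℝ := fun i => √(X i * (1 - a))
  set R : ι → ℝ := fun i => √(a * (1 - X i))
  have hS2 : ∀ i, S i ^ 2 = X i * (1 - a) := fun i =>
    Real.sq_sqrt (mul_nonneg (hX0 i) (by linarith))
  have hR2 : ∀ i, R i ^ 2 = a * (1 - X i) := fun i =>
    Real.sq_sqrt (mul_nonneg ha0.le (by linarith [hX1 i]))
  have hSR : ∀ i, S i * R i = F * √(X i * (1 - X i)) := fun i => by
    simp only [S, R, hF]
    rw [← Real.sqrt_mul (mul_nonneg (hX0 i) (by linarith)), ← Real.sqrt_mul hq.le]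
    congr 1
    ring
  have hsum : ∀ e : ℝ, e ^ 2 = 1 → ∑ i, k i * (S i + e * R i) ^ 2 = 2 * F ^ 2 + 2 * e * F * H := by
    intro e he
    have : ∀ i, k i * (S i + e * R i) ^ 2 = (1 - a) * (k i * X i) + a * (k i * (1 - X i))
        + 2 * e * F * (k i * √(X i * (1 - X i))) := fun i => by
      have : (S i + e * R i) ^ 2 = S i ^ 2 + e ^ 2 * R i ^ 2 + 2 * e * (S i * R i) := by ring
      rw [this, hS2, hR2, hSR, he]
      ring
    simp only [this, sum_add_distrib, ← mul_sum, ha, hb, ← hH, hF2]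
    ring
  -- Cauchy–Schwarz for `|X - a| = |S - R| (S + R)`
  have hcs : (∑ i, k i * |X i - a|) ^ 2 ≤ (2 * F ^ 2 - 2 * F * H) * (2 * F ^ 2 + 2 * F * H) := by
    have e1 := hsum (-1) (by norm_num)
    have e2 := hsum 1 (by norm_num)
    rw [show 2 * F ^ 2 - 2 * F * H = ∑ i, k i * (S i + -1 * R i) ^ 2 by rw [e1]; ring,
      show 2 * F ^ 2 + 2 * F * H = ∑ i, k i * (S i + 1 * R i) ^ 2 by rw [e2]; ring]
    refine sum_sq_le_sum_mul_sum_of_sq_le_mul univ (fun i _ => mul_nonneg (hk i) (sq_nonneg _))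
      (fun i _ => mul_nonneg (hk i) (sq_nonneg _)) fun i _ => le_of_eq ?_
    rw [mul_pow, sq_abs]
    have : X i - a = S i ^ 2 - R i ^ 2 := by rw [hS2, hR2]; ring
    rw [this]
    ring
  have hc2 : c ^ 2 ≤ F ^ 2 * (F ^ 2 - H ^ 2) := by
    have : (2 * c) ^ 2 ≤ (∑ i, k i * |X i - a|) ^ 2 := pow_le_pow_left₀ (by linarith) hc 2
    nlinarith
  have hFH : c ^ 2 / (2 * F ^ 3) ≤ F - H := by
    rw [div_le_iff₀ (by positivity)]
    nlinarith [mul_nonneg (pow_pos hF0 2).le (sq_nonneg (F - H))]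
  linarith

/-- One step of the averaging: the gain in `sum_sqrt_le_sub` bounded below by a supporting line of
the decay rate. Here `2 c ≤ ∑ k |X - a|` is required only for `0 < a < 1`. -/
theorem sum_sqrt_le_tangent {k X : ι → ℝ} {a c α β : ℝ} (hk : ∀ i, 0 ≤ k i) (hk1 : ∑ i, k i = 1)
    (hX0 : ∀ i, 0 ≤ X i) (hX1 : ∀ i, X i ≤ 1) (ha : ∑ i, k i * X i = a) (hc0 : 0 ≤ c)
    (hc : 0 < a → a < 1 → 2 * c ≤ ∑ i, k i * |X i - a|)
    (hα : α ≤ 0) (hαβ : ∀ z : ℝ, 0 < z → α + β * z ≤ (1 + z ^ 2) ^ 4 / z ^ 3) :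
    ∑ i, k i * √(X i * (1 - X i)) ≤
      √(a * (1 - a)) - c ^ 2 / 2 * (α * a + β * √(a * (1 - a))) := by
  have ha0 : 0 ≤ a := ha ▸ sum_nonneg fun i _ => mul_nonneg (hk i) (hX0 i)
  have ha1 : a ≤ 1 := by
    rw [← ha, ← hk1]
    exact sum_le_sum fun i _ => mul_le_of_le_one_right (hk i) (hX1 i)
  by_cases h01 : 0 < a ∧ a < 1
  · obtain ⟨h0, h1⟩ := h01
    have hq : 0 < a * (1 - a) := mul_pos h0 (by linarith)
    have h := sum_sqrt_le_sub hk hk1 hX0 hX1 ha h0 h1 hc0 (hc h0 h1)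
    have hF0 : 0 < √(a * (1 - a)) := Real.sqrt_pos.2 hq
    have hF2 : √(a * (1 - a)) ^ 2 = a * (1 - a) := Real.sq_sqrt hq.le
    set F := √(a * (1 - a))
    have t := hαβ (F / a) (by positivity)
    have e1 : 1 + (F / a) ^ 2 = 1 / a := by
      rw [div_pow, hF2]; field_simp; ring
    rw [e1] at t
    have t' := mul_le_mul_of_nonneg_left t h0.le
    have e2 : a * ((1 / a) ^ 4 / (F / a) ^ 3) = 1 / F ^ 3 := by field_simp
    have e3 : a * (α + β * (F / a)) = α * a + β * F := by field_simp
    rw [e2, e3] at t'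
    have t'' := mul_le_mul_of_nonneg_left t' (show 0 ≤ c ^ 2 / 2 by positivity)
    have e4 : c ^ 2 / 2 * (1 / F ^ 3) = c ^ 2 / (2 * F ^ 3) := by field_simp
    linarith
  · have h := sum_sqrt_le hk hk1 hX0 hX1 ha
    have hF : √(a * (1 - a)) = 0 := by
      rcases ha0.eq_or_lt with rfl | h0
      · simp
      · rw [show a = 1 from le_antisymm ha1 (not_lt.1 fun h1 => h01 ⟨h0, h1⟩)]
        simp
    rw [hF] at h ⊢
    have : c ^ 2 / 2 * (α * a) ≤ 0 :=
      mul_nonpos_of_nonneg_of_nonpos (by positivity) (mul_nonpos_of_nonpos_of_nonneg hα ha0)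
    linarith

/-! ### Layers of a function on a finite set -/

open MeasureTheory in
/-- The weight, among levels `u` in `(0, s]` with Lebesgue measure, of those for which the
superlevel set `{y | u ≤ g y}` equals `B`. -/
noncomputable def layerWeight {V : Type*} [Fintype V] (g : V → ℝ) (s : ℝ) (B : Finset V) : ℝ :=
  (volume.restrict (Set.Ioc 0 s)).real ((fun u : ℝ => univ.filter fun y => u ≤ g y) ⁻¹' {B})

section layers

open MeasureTheory

variable {V : Type*} [Fintype V] (g : V → ℝ)

theorem layerWeight_nonneg (s : ℝ) (B : Finset V) : 0 ≤ layerWeight g s B :=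
  measureReal_nonneg

theorem layerWeight_mono {s t : ℝ} (h : s ≤ t) (B : Finset V) :
    layerWeight g s B ≤ layerWeight g t B := by
  unfold layerWeight
  refine ENNReal.toReal_mono (measure_ne_top _ _) ?_
  exact Measure.restrict_mono (Set.Ioc_subset_Ioc_right h) le_rfl _

theorem measurableSet_superlevel_eq (B : Finset V) :
    MeasurableSet ((fun u : ℝ => univ.filter fun y => u ≤ g y) ⁻¹' {B}) := by
  have : ((fun u : ℝ => univ.filter fun y => u ≤ g y) ⁻¹' {B})
      = ⋂ y : V, {u : ℝ | u ≤ g y ↔ y ∈ B} := by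
    ext u
    simp [Finset.ext_iff]
  rw [this]
  refine MeasurableSet.iInter fun y => ?_
  by_cases hy : y ∈ B
  · simp only [hy, iff_true]
    exact measurableSet_Iic
  · simp only [hy, iff_false, not_le]
    exact measurableSet_Ioi

theorem sum_layerWeight_of_mem (s : ℝ) (T : Finset (Finset V)) :
    ∑ B ∈ T, layerWeight g s B = (volume.restrict (Set.Ioc 0 s)).real
      ((fun u : ℝ => univ.filter fun y => u ≤ g y) ⁻¹' T) :=
  sum_measureReal_preimage_singleton T fun B _ => measurableSet_superlevel_eq g B

theorem sum_layerWeight [DecidableEq V] {s : ℝ} (hs : 0 ≤ s) : ∑ B, layerWeight g s B = s := by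
  rw [sum_layerWeight_of_mem]
  simp [hs]

theorem sum_layerWeight_mem [DecidableEq V] {s : ℝ} (hs : 0 ≤ s) (y : V) (hg : 0 ≤ g y) :
    ∑ B, layerWeight g s B * (if y ∈ B then 1 else 0) = min (g y) s := by
  simp only [mul_ite, mul_one, mul_zero]
  rw [← sum_filter, sum_layerWeight_of_mem]
  have : ((fun u : ℝ => univ.filter fun y => u ≤ g y) ⁻¹'
      ((univ.filter fun B : Finset V => y ∈ B : Finset (Finset V)) : Set (Finset V)))
      = Set.Iic (g y) := by
    ext u
    simp
  rw [this, measureReal_restrict_apply measurableSet_Iic, Set.inter_comm, Set.Ioc_inter_Iic,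
    Real.volume_real_Ioc_of_le (le_min hs hg), min_comm, sub_zero]

theorem sum_layerWeight_mass [DecidableEq V] (π : V → ℝ) {s : ℝ} (hs : 0 ≤ s)
    (hg : ∀ y, 0 ≤ g y) :
    ∑ B, layerWeight g s B * mass π B = ∑ y, π y * min (g y) s := by
  simp only [mass, ← sum_layerWeight_mem g hs _ (hg _), mul_sum]
  rw [sum_comm]
  refine sum_congr rfl fun B _ => ?_
  rw [← sum_filter_add_sum_filter_not univ (· ∈ B) fun y => π y * _]
  simp only [filter_mem_eq_inter, univ_inter]
  rw [sum_eq_zero (s := univ.filter (· ∉ B)) fun y hy => by simp [(mem_filter.1 hy).2], add_zero]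
  exact sum_congr rfl fun y hy => by simp [hy, mul_comm]

/-- Twice the contribution of the levels up to `s` to the drift of a mean-zero function bounds its
first absolute moment from below. -/
theorem two_mul_sum_layerWeight_le_abs [DecidableEq V] (d : Finset V → ℝ) {s : ℝ}
    (hs : s ≤ 1) (hd : ∑ B, layerWeight g 1 B * d B = 0) :
    2 * ∑ B, layerWeight g s B * d B ≤ ∑ B, layerWeight g 1 B * |d B| := by
  have : 2 * ∑ B, layerWeight g s B * d B
      = ∑ B, (2 * layerWeight g s B - layerWeight g 1 B) * d B := by
    simp only [sub_mul, sum_sub_distrib, hd, sub_zero, mul_sum, mul_assoc]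
  rw [this]
  refine sum_le_sum fun B _ => (le_abs_self _).trans ?_
  rw [abs_mul]
  refine mul_le_mul_of_nonneg_right (abs_le.2 ⟨?_, ?_⟩) (abs_nonneg _)
  · linarith [layerWeight_nonneg g s B]
  · linarith [layerWeight_mono g hs B]

end layers

/-! ### Sizes and flows -/

section flows

variable {V : Type*} {P : Matrix V V ℝ} {π : V → ℝ}

theorem mass_nonneg (hπ : ∀ x, 0 ≤ π x) (A : Finset V) : 0 ≤ mass π A :=
  sum_nonneg fun x _ => hπ x

theorem mass_mono (hπ : ∀ x, 0 ≤ π x) {A B : Finset V} (h : A ⊆ B) : mass π A ≤ mass π B :=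
  sum_le_sum_of_subset_of_nonneg h fun x _ _ => hπ x

theorem mass_pos (hπ : ∀ x, 0 < π x) {A : Finset V} (h : A.Nonempty) : 0 < mass π A :=
  sum_pos (fun x _ => hπ x) h

theorem mass_insert [DecidableEq V] {v : V} {B : Finset V} (h : v ∉ B) :
    mass π (insert v B) = π v + mass π B :=
  sum_insert h

theorem flow_nonneg (hP : ∀ x y, 0 ≤ P x y) (hπ : ∀ x, 0 ≤ π x) (A B : Finset V) :
    0 ≤ flow P π A B :=
  sum_nonneg fun x _ => sum_nonneg fun y _ => mul_nonneg (hπ x) (hP x y)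

theorem flow_eq_sum_singleton (A B : Finset V) : flow P π A B = ∑ y ∈ B, flow P π A {y} := by
  simp only [flow, sum_singleton]
  exact sum_comm

theorem flow_mono (hP : ∀ x y, 0 ≤ P x y) (hπ : ∀ x, 0 ≤ π x) {A A' B B' : Finset V} (h : A ⊆ A')
    (h' : B ⊆ B') : flow P π A B ≤ flow P π A' B' :=
  (sum_le_sum fun x _ => sum_le_sum_of_subset_of_nonneg h'
    fun y _ _ => mul_nonneg (hπ x) (hP x y)).trans
    (sum_le_sum_of_subset_of_nonneg h fun x _ _ =>
      sum_nonneg fun y _ => mul_nonneg (hπ x) (hP x y))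

theorem flow_univ_right [Fintype V] (hP1 : ∀ x, ∑ y, P x y = 1) (A : Finset V) :
    flow P π A univ = mass π A := by
  simp only [flow, mass, ← mul_sum, hP1, mul_one]

theorem flow_univ_left [Fintype V] (hst : Matrix.vecMul π P = π) (y : V) :
    flow P π univ {y} = π y := by
  simpa [flow, Matrix.vecMul, dotProduct] using congrFun hst y

/-- The density `y ↦ Q(A, y) / π(y)` of the flow out of `A`. Its superlevel set at a uniformly
random level is one step of the evolving set process from `A`. -/
noncomputable def flowDensity (P : Matrix V V ℝ) (π : V → ℝ) (A : Finset V) (y : V) : ℝ :=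
  flow P π A {y} / π y

theorem mul_flowDensity (hπ : ∀ x, 0 < π x) (A : Finset V) (y : V) :
    π y * flowDensity P π A y = flow P π A {y} :=
  mul_div_cancel₀ _ (hπ y).ne'

theorem flowDensity_nonneg (hP : ∀ x y, 0 ≤ P x y) (hπ : ∀ x, 0 < π x) (A : Finset V) (y : V) :
    0 ≤ flowDensity P π A y :=
  div_nonneg (flow_nonneg hP (fun x => (hπ x).le) A {y}) (hπ y).le

theorem flowValues_nonneg [DecidableEq V] (hP : ∀ x y, 0 ≤ P x y) (hπ : ∀ x, 0 < π x)
    {A : Finset V} {t q : ℝ} (hq : q ∈ flowValues P π A t) : 0 ≤ q := by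
  obtain ⟨B, v, h1, -, rfl⟩ := hq
  have := flow_nonneg hP (fun x => (hπ x).le) A B
  have := mul_nonneg (sub_nonneg.2 h1) (flowDensity_nonneg hP hπ A v)
  unfold flowDensity at this
  linarith

theorem sum_mul_flowDensity [Fintype V] (hπ : ∀ x, 0 < π x) (hP1 : ∀ x, ∑ y, P x y = 1)
    (A : Finset V) : ∑ y, π y * flowDensity P π A y = mass π A := by
  simp only [mul_flowDensity hπ, ← flow_eq_sum_singleton, flow_univ_right hP1]

variable [Fintype V] [DecidableEq V]

theorem mass_compl (hπ1 : ∑ x, π x = 1) (A : Finset V) : mass π Aᶜ = 1 - mass π A := by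
  rw [← hπ1, mass, mass, ← sum_add_sum_compl A π]
  ring

theorem mass_le_one (hπ : ∀ x, 0 ≤ π x) (hπ1 : ∑ x, π x = 1) (A : Finset V) : mass π A ≤ 1 := by
  linarith [mass_compl hπ1 A, mass_nonneg hπ Aᶜ]

theorem flow_add_compl (A B : Finset V) : flow P π A B + flow P π Aᶜ B = flow P π univ B :=
  sum_add_sum_compl A _

theorem flowDensity_compl (hπ : ∀ x, 0 < π x) (hst : Matrix.vecMul π P = π) (A : Finset V)
    (y : V) : flowDensity P π Aᶜ y = 1 - flowDensity P π A y := by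
  rw [eq_sub_iff_add_eq', flowDensity, flowDensity, ← add_div, flow_add_compl, flow_univ_left hst,
    div_self (hπ y).ne']

theorem flowDensity_le_one (hP : ∀ x y, 0 ≤ P x y) (hπ : ∀ x, 0 < π x)
    (hst : Matrix.vecMul π P = π) (A : Finset V) (y : V) : flowDensity P π A y ≤ 1 := by
  linarith [flowDensity_compl hπ hst A y, flowDensity_nonneg hP hπ Aᶜ y]

/-! ### The modified ergodic flow -/

/-- The flow into a set `B` consisting of the vertices of smallest flow density, completed to
mass `t` by a fraction of the next vertex `v`, is a value over which `minFlow` minimizes. It is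
expressed through the truncation of the density at the level `s` of `v`. -/
theorem exists_truncation_mem_flowValues (hP : ∀ x y, 0 ≤ P x y) (hπ : ∀ x, 0 < π x)
    (hπ1 : ∑ x, π x = 1) (hst : Matrix.vecMul π P = π) (A : Finset V) {t : ℝ} (ht0 : 0 ≤ t)
    (ht1 : t < 1) :
    ∃ s : ℝ, 0 ≤ s ∧ s ≤ 1 ∧
      ∑ y, π y * min (flowDensity P π A y) s - s * (1 - t) ∈ flowValues P π A t := by
  set g := flowDensity P π A with hg
  obtain ⟨B, hB, hmax⟩ := exists_max_image
    (univ.filter fun B : Finset V => (∀ y ∈ B, ∀ z ∉ B, g y ≤ g z) ∧ mass π B ≤ t) card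
    ⟨∅, mem_filter.2 ⟨mem_univ _, by simp, by simpa [mass] using ht0⟩⟩
  obtain ⟨hlow, hBt⟩ := (mem_filter.1 hB).2
  have hne : Bᶜ.Nonempty := by
    rw [nonempty_iff_ne_empty, Ne, compl_eq_empty_iff]
    rintro rfl
    simp only [mass, hπ1] at hBt
    linarith
  obtain ⟨v, hv, hvmin⟩ := exists_min_image Bᶜ g hne
  have hvB : v ∉ B := mem_compl.1 hv
  have hlt : t < mass π (insert v B) := by
    by_contra! hle
    have hmem := hmax (insert v B) (mem_filter.2 ⟨mem_univ _, fun y hy z hz => ?_, hle⟩)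
    · rw [card_insert_of_notMem hvB] at hmem
      omega
    · have hzB : z ∉ B := fun h => hz (mem_insert_of_mem h)
      rcases mem_insert.1 hy with rfl | hy
      · exact hvmin z (mem_compl.2 hzB)
      · exact hlow y hy z hzB
  refine ⟨g v, flowDensity_nonneg hP hπ A v, flowDensity_le_one hP hπ hst A v, B, v, hBt, hlt, ?_⟩
  have e1 : ∑ y ∈ B, π y * min (g y) (g v) = flow P π A B := by
    rw [flow_eq_sum_singleton]
    refine sum_congr rfl fun y hy => ?_
    rw [min_eq_left (hlow y hy v hvB), hg, mul_flowDensity hπ]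
  have e2 : ∑ y ∈ Bᶜ, π y * min (g y) (g v) = (1 - mass π B) * g v := by
    rw [← mass_compl hπ1, mass, sum_mul]
    refine sum_congr rfl fun y hy => ?_
    rw [min_eq_right (hvmin y hy)]
  rw [← sum_add_sum_compl B, e1, e2]
  change _ = flow P π A B + (t - mass π B) * g v
  ring

/-- To bound the modified flow of a non-empty set from below it suffices to bound each of the values
over which it minimizes: the set of values is non-empty, so that its infimum is no junk value. -/
theorem le_modifiedFlow (hP : ∀ x y, 0 ≤ P x y) (hπ : ∀ x, 0 < π x)
    (hπ1 : ∑ x, π x = 1) (hst : Matrix.vecMul π P = π) {A : Finset V} (hA : A.Nonempty) {c : ℝ}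
    (h : ∀ q ∈ flowValues P π A (mass π Aᶜ), c ≤ q) : c ≤ modifiedFlow P π A := by
  obtain ⟨s, -, -, hs⟩ := exists_truncation_mem_flowValues hP hπ hπ1 hst A
    (mass_nonneg (fun x => (hπ x).le) Aᶜ) (by linarith [mass_compl hπ1 A, mass_pos hπ hA])
  exact le_csInf ⟨_, hs⟩ h

/-- The modified flows of `A` and of its complement are at most half of the mean absolute change of
size in an evolving set step from `A`. -/
theorem two_mul_modifiedFlow_le (hP : ∀ x y, 0 ≤ P x y) (hP1 : ∀ x, ∑ y, P x y = 1)
    (hπ : ∀ x, 0 < π x) (hπ1 : ∑ x, π x = 1) (hst : Matrix.vecMul π P = π) {A : Finset V}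
    (hA : A.Nonempty) (hAu : A ≠ univ) :
    2 * modifiedFlow P π A
        ≤ ∑ B, layerWeight (flowDensity P π A) 1 B * |mass π B - mass π A| ∧
    2 * modifiedFlow P π Aᶜ
        ≤ ∑ B, layerWeight (flowDensity P π A) 1 B * |mass π B - mass π A| := by
  have hπ' : ∀ x, 0 ≤ π x := fun x => (hπ x).le
  have hg := flowDensity_nonneg hP hπ A
  have hsum := sum_mul_flowDensity hπ hP1 A
  have hdrift : ∀ s, 0 ≤ s → ∑ B, layerWeight (flowDensity P π A) s B * (mass π B - mass π A)
      = ∑ y, π y * min (flowDensity P π A y) s - s * mass π A := fun s hs => by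
    simp only [mul_sub, sum_sub_distrib, sum_layerWeight_mass _ π hs hg, ← sum_mul,
      sum_layerWeight _ hs]
  have hd : ∑ B, layerWeight (flowDensity P π A) 1 B * (mass π B - mass π A) = 0 := by
    rw [hdrift 1 zero_le_one]
    simp only [min_eq_left (flowDensity_le_one hP hπ hst A _), hsum]
    ring
  have hbdd : ∀ A' : Finset V, ∀ q ∈ flowValues P π A' (mass π A'ᶜ), modifiedFlow P π A' ≤ q :=
    fun A' q hq => csInf_le ⟨0, fun q hq => flowValues_nonneg hP hπ hq⟩ hq
  have hcompl : Aᶜ.Nonempty := by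
    rw [nonempty_iff_ne_empty, Ne, compl_eq_empty_iff]
    exact hAu
  constructor
  · obtain ⟨s, hs0, hs1, hs⟩ := exists_truncation_mem_flowValues hP hπ hπ1 hst A
      (mass_nonneg hπ' Aᶜ) (by linarith [mass_compl hπ1 A, mass_pos hπ hA])
    refine le_trans ?_ (two_mul_sum_layerWeight_le_abs _ _ hs1 hd)
    have := hbdd A _ hs
    rw [hdrift s hs0]
    rw [mass_compl hπ1, sub_sub_cancel] at this
    linarith
  · obtain ⟨s, hs0, hs1, hs⟩ := exists_truncation_mem_flowValues hP hπ hπ1 hst Aᶜ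
      (mass_nonneg hπ' Aᶜᶜ) (by linarith [mass_compl hπ1 Aᶜ, mass_pos hπ hcompl])
    refine le_trans ?_ (two_mul_sum_layerWeight_le_abs _ _ (s := 1 - s) (by linarith) hd)
    have := hbdd Aᶜ _ hs
    rw [hdrift (1 - s) (by linarith)]
    -- passing to the complement reflects densities and levels at `1 / 2`
    have e : ∀ y, π y * min (flowDensity P π Aᶜ y) s
        = π y * min (flowDensity P π A y) (1 - s) + s * π y - π y * flowDensity P π A y := by
      intro y
      rw [flowDensity_compl hπ hst]
      rcases le_total (flowDensity P π A y) (1 - s) with h | h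
      · rw [min_eq_left h, min_eq_right (by linarith)]; ring
      · rw [min_eq_right h, min_eq_left (by linarith)]; ring
    simp only [e, sum_sub_distrib, sum_add_distrib, ← mul_sum, hπ1, hsum, mass_compl hπ1] at this
    linarith

end flows

/-! ### The evolving set process and the `L²` distance -/

section evolving

variable {V : Type*} [Fintype V] [DecidableEq V] {P : Matrix V V ℝ} {π : V → ℝ}

/-- Transition matrix of the evolving set process: from `A` it moves to
`{y | u ≤ Q(A, y) / π(y)}` with `u` uniform in `(0, 1]`. -/
noncomputable def evolvingKernel (P : Matrix V V ℝ) (π : V → ℝ) :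
    Matrix (Finset V) (Finset V) ℝ :=
  fun A B => layerWeight (flowDensity P π A) 1 B

theorem evolvingKernel_pow_nonneg (n : ℕ) (A B : Finset V) :
    0 ≤ (evolvingKernel P π ^ n) A B := by
  induction n generalizing B with
  | zero => rw [pow_zero, Matrix.one_apply]; split_ifs <;> norm_num
  | succ n ih =>
    rw [pow_succ, Matrix.mul_apply]
    exact sum_nonneg fun C _ => mul_nonneg (ih C) (layerWeight_nonneg _ _ _)

theorem sum_evolvingKernel_pow_succ (n : ℕ) (A : Finset V) (F : Finset V → ℝ) :
    ∑ B, (evolvingKernel P π ^ (n + 1)) A B * F B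
      = ∑ C, (evolvingKernel P π ^ n) A C * ∑ B, evolvingKernel P π C B * F B := by
  simp only [pow_succ, Matrix.mul_apply, sum_mul, mul_sum, mul_assoc]
  exact sum_comm

/-- Duality between the chain and the evolving sets: `π(x) Pⁿ(x, y) = π(y) ℙ(y ∈ Sₙ)` when
`S₀ = {x}`. -/
theorem sum_evolvingKernel_pow_mem (hP : ∀ x y, 0 ≤ P x y) (hπ : ∀ x, 0 < π x)
    (hst : Matrix.vecMul π P = π) (n : ℕ) (x y : V) :
    ∑ A, (evolvingKernel P π ^ n) {x} A * (if y ∈ A then 1 else 0)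
      = π x * (P ^ n) x y / π y := by
  induction n generalizing y with
  | zero =>
    simp only [pow_zero, Matrix.one_apply, ite_mul, one_mul, zero_mul, sum_ite_eq, mem_univ,
      if_true, mem_singleton]
    by_cases h : x = y
    · subst h
      simp [(hπ x).ne']
    · simp [h, Ne.symm h]
  | succ n ih =>
    rw [sum_evolvingKernel_pow_succ]
    have h : ∀ C, ∑ B, evolvingKernel P π C B * (if y ∈ B then 1 else 0) = flowDensity P π C y :=
      fun C => by
        rw [← min_eq_left (flowDensity_le_one hP hπ hst C y)]
        exact sum_layerWeight_mem _ zero_le_one y (flowDensity_nonneg hP hπ C y)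
    simp only [h, flowDensity, flow, sum_singleton]
    have e : ∀ C : Finset V, ∑ z ∈ C, π z * P z y
        = ∑ z, (if z ∈ C then 1 else 0) * (π z * P z y) := fun C => by simp
    simp only [e, ← mul_div_assoc, mul_sum, ← sum_div]
    rw [sum_comm, pow_succ, Matrix.mul_apply, mul_sum]
    congr 1
    refine sum_congr rfl fun z _ => ?_
    simp only [← mul_assoc, ← sum_mul, ih]
    rw [div_mul_cancel₀ _ (hπ z).ne']

theorem sum_pow_apply (hP1 : ∀ x, ∑ y, P x y = 1) (n : ℕ) (x : V) : ∑ y, (P ^ n) x y = 1 := by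
  induction n with
  | zero => simp [Matrix.one_apply]
  | succ n ih =>
    simp only [pow_succ, Matrix.mul_apply]
    rw [sum_comm]
    simp only [← mul_sum, hP1, mul_one, ih]

theorem sum_evolvingKernel_pow_mass (hP : ∀ x y, 0 ≤ P x y) (hP1 : ∀ x, ∑ y, P x y = 1)
    (hπ : ∀ x, 0 < π x) (hst : Matrix.vecMul π P = π) (n : ℕ) (x : V) :
    ∑ A, (evolvingKernel P π ^ n) {x} A * mass π A = π x := by
  have e : ∀ A : Finset V, mass π A = ∑ y, (if y ∈ A then 1 else 0) * π y := fun A => by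
    simp [mass]
  simp only [e, mul_sum, ← mul_assoc]
  rw [sum_comm]
  simp only [← sum_mul, sum_evolvingKernel_pow_mem hP hπ hst]
  simp only [div_mul_cancel₀ _ (hπ _).ne', ← mul_sum, sum_pow_apply hP1, mul_one]

/-- The `L²` distance to stationarity is at most the mean of `√(a (1 - a)) / π(x)` for
`a = π(Sₙ)`, by Minkowski's inequality. -/
theorem l2Dist_le_sum_evolvingKernel (hP : ∀ x y, 0 ≤ P x y) (hP1 : ∀ x, ∑ y, P x y = 1)
    (hπ : ∀ x, 0 < π x) (hπ1 : ∑ x, π x = 1) (hst : Matrix.vecMul π P = π) (n : ℕ) (x : V) :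
    l2Dist ((P ^ n) x) π
      ≤ (∑ A, (evolvingKernel P π ^ n) {x} A * √(mass π A * (1 - mass π A))) / π x := by
  set w := fun A => (evolvingKernel P π ^ n) {x} A with hw
  have hw0 : ∀ A, 0 ≤ w A := evolvingKernel_pow_nonneg n {x}
  -- the centred indicator of `A`, scaled so that its Euclidean norm is its norm in `L²(π)`
  set ξ : Finset V → EuclideanSpace ℝ V := fun A =>
    WithLp.toLp 2 fun y => √(π y) * ((if y ∈ A then 1 else 0) - mass π A) with hξ
  have hnorm : ∀ A, ‖ξ A‖ = √(mass π A * (1 - mass π A)) := fun A => by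
    rw [EuclideanSpace.norm_eq]
    congr 1
    have : ∀ y, ‖ξ A y‖ ^ 2 = (if y ∈ A then π y else 0) * (1 - 2 * mass π A)
        + mass π A ^ 2 * π y := fun y => by
      simp only [hξ, Real.norm_eq_abs, sq_abs, mul_pow, Real.sq_sqrt (hπ y).le]
      split_ifs <;> ring
    simp only [this, sum_add_distrib, ← sum_mul, ← mul_sum, hπ1]
    have : ∑ y, (if y ∈ A then π y else 0) = mass π A := by simp [mass]
    rw [this]
    ring
  have hcomb : l2Dist ((P ^ n) x) π = ‖(π x)⁻¹ • ∑ A, w A • ξ A‖ := by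
    rw [l2Dist, EuclideanSpace.norm_eq]
    congr 1
    refine sum_congr rfl fun y _ => ?_
    have e : (∑ A, w A • ξ A) y = √(π y) * (π x * ((P ^ n) x y / π y - 1)) := by
      have h1 := sum_evolvingKernel_pow_mem hP hπ hst n x y
      have h2 := sum_evolvingKernel_pow_mass hP hP1 hπ hst n x
      rw [mul_sub, mul_one, ← mul_div_assoc, ← h1]
      conv_rhs => rw [← h2]
      rw [← sum_sub_distrib, mul_sum]
      simp only [hξ, WithLp.ofLp_sum, WithLp.ofLp_smul, Finset.sum_apply, Pi.smul_apply,
        smul_eq_mul]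
      exact sum_congr rfl fun A _ => by ring
    rw [PiLp.smul_apply, e, smul_eq_mul, Real.norm_eq_abs, sq_abs]
    have : (π x)⁻¹ * (√(π y) * (π x * ((P ^ n) x y / π y - 1)))
        = √(π y) * ((P ^ n) x y / π y - 1) := by
      have := (hπ x).ne'
      field_simp
    rw [this, mul_pow, Real.sq_sqrt (hπ y).le]
  rw [hcomb, norm_smul, Real.norm_of_nonneg (inv_nonneg.2 (hπ x).le), div_eq_inv_mul]
  refine mul_le_mul_of_nonneg_left ((norm_sum_le _ _).trans (sum_le_sum fun A _ => ?_))
    (inv_nonneg.2 (hπ x).le)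
  rw [norm_smul, hnorm, Real.norm_of_nonneg (hw0 A)]

/-- The `L²` functional along the evolving sets decays at least with the rate `decayRate`. The
supporting line of the rate is averaged against the probability weights `w(A) π(A) / π(x)`, the
law of the process conditioned to be absorbed in `V`. -/
theorem evolvingKernel_decay (hP : ∀ x y, 0 ≤ P x y) (hP1 : ∀ x, ∑ y, P x y = 1)
    (hπ : ∀ x, 0 < π x) (hπ1 : ∑ x, π x = 1) (hst : Matrix.vecMul π P = π) {c : ℝ} (hc : 0 ≤ c)
    (hΨ : ∀ A : Finset V, A.Nonempty → A ≠ univ →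
      c ≤ modifiedFlow P π A ∨ c ≤ modifiedFlow P π Aᶜ) (x : V) (n : ℕ) {l : ℕ → ℝ}
    (hl : ∀ n, l n = (∑ A, (evolvingKernel P π ^ n) {x} A * √(mass π A * (1 - mass π A))) / π x) :
    l (n + 1) ≤ l n - c ^ 2 / 2 * decayRate (l n) := by
  obtain ⟨α, β, hα, hαβ, hline⟩ := exists_decayRate_tangent (l n)
  have hπ' : ∀ x, 0 ≤ π x := fun x => (hπ x).le
  have hstep : ∀ A, ∑ B, evolvingKernel P π A B * √(mass π B * (1 - mass π B)) ≤
      √(mass π A * (1 - mass π A))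
        - c ^ 2 / 2 * (α * mass π A + β * √(mass π A * (1 - mass π A))) := fun A => by
    refine sum_sqrt_le_tangent (layerWeight_nonneg _ 1) (sum_layerWeight _ zero_le_one)
      (mass_nonneg hπ') (mass_le_one hπ' hπ1) ?_ hc (fun h0 h1 => ?_) hα hαβ
    · refine (sum_layerWeight_mass _ π zero_le_one (flowDensity_nonneg hP hπ A)).trans ?_
      simp only [min_eq_left (flowDensity_le_one hP hπ hst A _), sum_mul_flowDensity hπ hP1]
    · have hA : A.Nonempty := by
        rw [nonempty_iff_ne_empty]
        rintro rfl
        simp [mass] at h0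
      have hAu : A ≠ univ := by
        rintro rfl
        simp [mass, hπ1] at h1
      obtain ⟨t1, t2⟩ := two_mul_modifiedFlow_le hP hP1 hπ hπ1 hst hA hAu
      rcases hΨ A hA hAu with h | h
      · exact le_trans (by linarith) t1
      · exact le_trans (by linarith) t2
  have hmass := sum_evolvingKernel_pow_mass hP hP1 hπ hst n x
  have hsum : ∑ A, (evolvingKernel P π ^ n) {x} A * √(mass π A * (1 - mass π A)) = π x * l n := by
    rw [hl, mul_div_cancel₀ _ (hπ x).ne']
  rw [hl (n + 1), div_le_iff₀ (hπ x), sum_evolvingKernel_pow_succ, ← hline]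
  refine (sum_le_sum fun A _ =>
    mul_le_mul_of_nonneg_left (hstep A) (evolvingKernel_pow_nonneg n {x} A)).trans (le_of_eq ?_)
  have e : ∀ A, (evolvingKernel P π ^ n) {x} A * (√(mass π A * (1 - mass π A))
        - c ^ 2 / 2 * (α * mass π A + β * √(mass π A * (1 - mass π A))))
      = (1 - c ^ 2 / 2 * β) * ((evolvingKernel P π ^ n) {x} A * √(mass π A * (1 - mass π A)))
        - c ^ 2 / 2 * α * ((evolvingKernel P π ^ n) {x} A * mass π A) := fun A => by ring
  simp only [e, sum_sub_distrib, ← mul_sum, hmass, hsum]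
  ring

/-- A uniform lower bound `c` on the modified flow bounds the `L²` mixing time by
`⌈(1 / 12 + log (1 / ε) / 8) / c²⌉`. -/
theorem l2MixingTime_le (hP : ∀ x y, 0 ≤ P x y) (hP1 : ∀ x, ∑ y, P x y = 1)
    (hπ : ∀ x, 0 < π x) (hst : IsStationary P π) {c : ℝ} (hc : 0 < c)
    (hΨ : ∀ A : Finset V, A.Nonempty → A ≠ univ →
      c ≤ modifiedFlow P π A ∨ c ≤ modifiedFlow P π Aᶜ) {ε : ℝ} (hε : 0 < ε) (hε1 : ε ≤ 1) :
    l2MixingTime P π ε ≤ (⌈(1 / 12 + Real.log (1 / ε) / 8) / c ^ 2⌉₊ : ℕ∞) := by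
  refine iInf₂_le _ fun x => ?_
  refine (l2Dist_le_sum_evolvingKernel hP hP1 hπ hst.2.1 hst.2.2 _ x).trans ?_
  exact le_of_decayRate (pow_pos hc 2)
    (l := fun n => (∑ A, (evolvingKernel P π ^ n) {x} A * √(mass π A * (1 - mass π A))) / π x)
    (fun n => div_nonneg (sum_nonneg fun A _ =>
      mul_nonneg (evolvingKernel_pow_nonneg n {x} A) (Real.sqrt_nonneg _)) (hπ x).le)
    (fun n => evolvingKernel_decay hP hP1 hπ hst.2.1 hst.2.2 hc.le hΨ x n fun _ => rfl)
    hε hε1 (Nat.le_ceil _)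

end evolving

/-! ### Random walks on Eulerian graphs -/

section graphs

variable {V : Type*} [Fintype V] {G : Digraph V}

theorem sum_outDeg (G : Digraph V) : ∑ x, outDeg G x = numEdges G := by
  classical
  simp only [outDeg, numEdges, card_filter, Fintype.sum_prod_type]

theorem IsEulerian.outDeg_pos (hG : IsEulerian G) (hm : 0 < numEdges G) (x : V) :
    0 < outDeg G x := by
  classical
  obtain ⟨⟨p, q⟩, hpq⟩ := card_pos.1 hm
  have hpq : G.Adj p q := (mem_filter.1 hpq).2
  obtain ⟨y, hy⟩ : ∃ y, G.Adj x y := by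
    rcases (hG.stronglyConnected x p).cases_head with rfl | ⟨y, hy, -⟩
    · exact ⟨q, hpq⟩
    · exact ⟨y, hy⟩
  exact card_pos.2 ⟨y, mem_filter.2 ⟨mem_univ _, hy⟩⟩

theorem IsEulerian.inv_numEdges_le_degDist (hG : IsEulerian G) (hm : 0 < numEdges G) (x : V) :
    1 / (numEdges G : ℝ) ≤ degDist G x :=
  div_le_div_of_nonneg_right (by exact_mod_cast hG.outDeg_pos hm x) (Nat.cast_nonneg _)

theorem IsEulerian.degDist_pos (hG : IsEulerian G) (hm : 0 < numEdges G) (x : V) :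
    0 < degDist G x :=
  div_pos (by exact_mod_cast hG.outDeg_pos hm x) (by exact_mod_cast hm)

theorem sum_degDist (hm : 0 < numEdges G) : ∑ x, degDist G x = 1 := by
  have : (numEdges G : ℝ) ≠ 0 := by exact_mod_cast hm.ne'
  simp only [degDist, ← sum_div, ← Nat.cast_sum, sum_outDeg, div_self this]

theorem simpleWalk_nonneg (G : Digraph V) (x y : V) : 0 ≤ simpleWalk G x y := by
  unfold simpleWalk
  split_ifs <;> positivity

theorem IsEulerian.sum_simpleWalk (hG : IsEulerian G) (hm : 0 < numEdges G) (x : V) :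
    ∑ y, simpleWalk G x y = 1 := by
  classical
  have : (outDeg G x : ℝ) ≠ 0 := by exact_mod_cast (hG.outDeg_pos hm x).ne'
  simp only [simpleWalk, ← sum_filter, sum_const, nsmul_eq_mul]
  exact mul_one_div_cancel this

open Classical in
/-- Every edge carries the same flow `1 / m`. -/
theorem IsEulerian.degDist_mul_simpleWalk (hG : IsEulerian G) (hm : 0 < numEdges G) (x y : V) :
    degDist G x * simpleWalk G x y = if G.Adj x y then 1 / (numEdges G : ℝ) else 0 := by
  have : (outDeg G x : ℝ) ≠ 0 := by exact_mod_cast (hG.outDeg_pos hm x).ne'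
  unfold degDist simpleWalk
  split_ifs
  · field_simp
  · simp

theorem IsEulerian.isStationary_simpleWalk (hG : IsEulerian G) (hm : 0 < numEdges G) :
    IsStationary (simpleWalk G) (degDist G) := by
  classical
  refine ⟨fun x => (hG.degDist_pos hm x).le, sum_degDist hm, funext fun y => ?_⟩
  simp only [Matrix.vecMul, dotProduct, hG.degDist_mul_simpleWalk hm, ← sum_filter, sum_const,
    nsmul_eq_mul]
  rw [degDist, ← hG.inDeg_eq_outDeg, mul_one_div, inDeg]

theorem IsEulerian.inv_numEdges_le_flow (hG : IsEulerian G) (hm : 0 < numEdges G)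
    {A B : Finset V} {x y : V} (hx : x ∈ A) (hy : y ∈ B) (h : G.Adj x y) :
    1 / (numEdges G : ℝ) ≤ flow (simpleWalk G) (degDist G) A B := by
  refine le_trans (le_of_eq ?_) (flow_mono (simpleWalk_nonneg G)
    (fun x => (hG.degDist_pos hm x).le) (singleton_subset_iff.2 hx) (singleton_subset_iff.2 hy))
  simp [flow, hG.degDist_mul_simpleWalk hm, h]

theorem exists_adj_of_flow_pos {A : Finset V} {y : V}
    (h : 0 < flow (simpleWalk G) (degDist G) A {y}) : ∃ x ∈ A, G.Adj x y := by
  by_contra! hn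
  refine h.ne' (sum_eq_zero fun x hx => ?_)
  simp [simpleWalk, hn x hx]

/-- Strong connectivity: some edge leaves every non-trivial set of vertices. -/
theorem IsEulerian.exists_adj_notMem (hG : IsEulerian G) {A : Finset V} (hA : A.Nonempty)
    (hAu : A ≠ univ) : ∃ x ∈ A, ∃ y ∉ A, G.Adj x y := by
  by_contra! hn
  obtain ⟨x, hx⟩ := hA
  refine hAu (eq_univ_iff_forall.2 fun y => ?_)
  induction hG.stronglyConnected x y with
  | refl => exact hx
  | tail _ hbc ih => exact not_imp_not.1 (fun hc => hn _ ih _ hc) hbc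

variable [DecidableEq V]

/-- Under weak expansion, `N(A) \ {v}` and a set `B` with `π(B ∪ {v}) > π(Aᶜ)` are too large to
be disjoint, so that an edge from `A` to `B` exists. -/
theorem IsEulerian.le_modifiedFlow_simpleWalk (hG : IsEulerian G) (hm : 0 < numEdges G)
    (hexp : WeakExpansion (simpleWalk G) (degDist G)) {A : Finset V} (hA : A.Nonempty)
    (hA2 : mass (degDist G) A ≤ 1 / 2) :
    1 / (numEdges G : ℝ) ≤ modifiedFlow (simpleWalk G) (degDist G) A := by
  have hπ := hG.degDist_pos hm
  have hπ' : ∀ x, 0 ≤ degDist G x := fun x => (hπ x).le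
  have hπ1 := sum_degDist hm
  refine le_modifiedFlow (simpleWalk_nonneg G) hπ hπ1 (hG.isStationary_simpleWalk hm).2.2 hA ?_
  rintro q ⟨B, v, hB, hBv, rfl⟩
  have hvB : v ∉ B := fun h => by
    rw [insert_eq_of_mem h] at hBv
    linarith
  have hmeet : ¬ Disjoint (neighborhood (simpleWalk G) (degDist G) A \ {v}) B := fun hdis => by
    have h1 := hexp A hA2 v
    have h2 : mass (degDist G)
        (insert v (neighborhood (simpleWalk G) (degDist G) A \ {v} ∪ B)) ≤ 1 :=
      mass_le_one hπ' hπ1 _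
    rw [mass_insert (by simp [hvB])] at h2
    have h3 : mass (degDist G) (neighborhood (simpleWalk G) (degDist G) A \ {v} ∪ B)
      = mass (degDist G) (neighborhood (simpleWalk G) (degDist G) A \ {v}) + mass (degDist G) B :=
      sum_union hdis
    rw [mass_insert hvB, mass_compl hπ1] at hBv
    linarith
  obtain ⟨y, hyN, hyB⟩ := not_disjoint_iff.1 hmeet
  obtain ⟨x, hx, hxy⟩ := exists_adj_of_flow_pos (mem_filter.1 (mem_sdiff.1 hyN).1).2
  have h1 := hG.inv_numEdges_le_flow hm hx hyB hxy
  have h2 := mul_nonneg (sub_nonneg.2 hB) (flowDensity_nonneg (simpleWalk_nonneg G) hπ A v)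
  unfold flowDensity at h2
  linarith

theorem lazyWalk_apply (G : Digraph V) (x y : V) :
    lazyWalk G x y = ((if x = y then 1 else 0) + simpleWalk G x y) / 2 := by
  simp only [lazyWalk, Matrix.smul_apply, Matrix.add_apply, Matrix.one_apply, smul_eq_mul]
  ring

theorem lazyWalk_nonneg (G : Digraph V) (x y : V) : 0 ≤ lazyWalk G x y := by
  rw [lazyWalk_apply]
  have := simpleWalk_nonneg G x y
  split_ifs <;> positivity

theorem IsEulerian.sum_lazyWalk (hG : IsEulerian G) (hm : 0 < numEdges G) (x : V) :
    ∑ y, lazyWalk G x y = 1 := by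
  simp only [lazyWalk_apply, ← sum_div, sum_add_distrib, hG.sum_simpleWalk hm, sum_ite_eq,
    mem_univ, if_true]
  norm_num

theorem IsEulerian.isStationary_lazyWalk (hG : IsEulerian G) (hm : 0 < numEdges G) :
    IsStationary (lazyWalk G) (degDist G) := by
  obtain ⟨h0, h1, h2⟩ := hG.isStationary_simpleWalk hm
  refine ⟨h0, h1, ?_⟩
  rw [lazyWalk, Matrix.vecMul_smul, Matrix.vecMul_add, Matrix.vecMul_one, h2, ← two_smul ℝ,
    smul_smul]
  norm_num

theorem IsEulerian.half_degDist_le_flow (hG : IsEulerian G) (hm : 0 < numEdges G)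
    {A B : Finset V} {x : V} (hA : x ∈ A) (hB : x ∈ B) :
    degDist G x / 2 ≤ flow (lazyWalk G) (degDist G) A B := by
  refine le_trans ?_ (flow_mono (lazyWalk_nonneg G)
    (fun x => (hG.degDist_pos hm x).le) (singleton_subset_iff.2 hA) (singleton_subset_iff.2 hB))
  simp only [flow, sum_singleton, lazyWalk_apply, if_true]
  have := mul_nonneg (hG.degDist_pos hm x).le (simpleWalk_nonneg G x x)
  linarith

theorem IsEulerian.half_flow_le_flow_lazyWalk (hG : IsEulerian G) (hm : 0 < numEdges G)
    (A B : Finset V) :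
    flow (simpleWalk G) (degDist G) A B / 2 ≤ flow (lazyWalk G) (degDist G) A B := by
  simp only [flow, sum_div]
  refine sum_le_sum fun x _ => sum_le_sum fun y _ => ?_
  rw [mul_div_assoc, lazyWalk_apply]
  refine mul_le_mul_of_nonneg_left ?_ (hG.degDist_pos hm x).le
  split_ifs <;> linarith

/-- A competitor `B` meets `A`, or equals `Aᶜ`, or misses a vertex of `Aᶜ`; in the last case the
mass that is missing is supplied from a vertex of `A`, which retains half of its mass. -/
theorem IsEulerian.le_modifiedFlow_lazyWalk (hG : IsEulerian G) (hm : 0 < numEdges G)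
    {A : Finset V} (hA : A.Nonempty) (hAu : A ≠ univ) :
    1 / (2 * (numEdges G : ℝ)) ≤ modifiedFlow (lazyWalk G) (degDist G) A := by
  have hπ := hG.degDist_pos hm
  have hπ' : ∀ x, 0 ≤ degDist G x := fun x => (hπ x).le
  have hπ1 := sum_degDist hm
  refine le_modifiedFlow (lazyWalk_nonneg G) hπ hπ1 (hG.isStationary_lazyWalk hm).2.2 hA ?_
  rintro q ⟨B, v, hB, hBv, rfl⟩
  have hhalf : 1 / (2 * (numEdges G : ℝ)) = 1 / (numEdges G : ℝ) / 2 := by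
    rw [div_div, mul_comm]
  rw [hhalf]
  have h0 := flow_nonneg (lazyWalk_nonneg G) hπ' A B
  have hfrac := mul_nonneg (sub_nonneg.2 hB) (flowDensity_nonneg (lazyWalk_nonneg G) hπ A v)
  unfold flowDensity at hfrac
  by_cases hdis : Disjoint B A
  · have hsub : B ⊆ Aᶜ := fun x hx => mem_compl.2 (disjoint_left.1 hdis hx)
    by_cases hBA : B = Aᶜ
    · obtain ⟨x, hx, y, hy, hxy⟩ := hG.exists_adj_notMem hA hAu
      have h1 := hG.inv_numEdges_le_flow hm hx (hBA ▸ mem_compl.2 hy : y ∈ B) hxy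
      have h2 := hG.half_flow_le_flow_lazyWalk hm A B
      linarith
    · obtain ⟨y, hyA, hyB⟩ := exists_of_ssubset (hsub.ssubset_of_ne hBA)
      have hvA : v ∈ A := by
        by_contra hv
        have := mass_mono hπ' (insert_subset (mem_compl.2 hv) hsub)
        linarith
      have h1 : 1 / (numEdges G : ℝ) ≤ mass (degDist G) Aᶜ - mass (degDist G) B := by
        have h2 := mass_mono hπ' (insert_subset hyA hsub)
        rw [mass_insert hyB] at h2
        linarith [hG.inv_numEdges_le_degDist hm y]
      have h3 : 1 / 2 ≤ flow (lazyWalk G) (degDist G) A {v} / degDist G v := by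
        rw [le_div_iff₀ (hπ v)]
        linarith [hG.half_degDist_le_flow hm hvA (mem_singleton_self v)]
      have h4 : 1 / (numEdges G : ℝ) * (1 / 2) ≤ _ :=
        mul_le_mul h1 h3 (by norm_num) (sub_nonneg.2 hB)
      linarith
  · obtain ⟨x, hxB, hxA⟩ := not_disjoint_iff.1 hdis
    have h1 := hG.half_degDist_le_flow hm hxA hxB
    linarith [hG.inv_numEdges_le_degDist hm x]

end graphs

end MarkovMixing

theorem mainTheorem11 {V : Type*} [Fintype V] [DecidableEq V] (G : Digraph V)
    (hG : MarkovMixing.IsEulerian G) (m : ℕ) (hm : MarkovMixing.numEdges G = m) (hm0 : 0 < m) :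
    MarkovMixing.IsStationary (MarkovMixing.simpleWalk G) (MarkovMixing.degDist G) ∧
    MarkovMixing.IsStationary (MarkovMixing.lazyWalk G) (MarkovMixing.degDist G) ∧
    (MarkovMixing.WeakExpansion (MarkovMixing.simpleWalk G) (MarkovMixing.degDist G) →
      (∀ A : Finset V, A.Nonempty → MarkovMixing.mass (MarkovMixing.degDist G) A ≤ 1 / 2 →
        1 / (m : ℝ) ≤
          MarkovMixing.modifiedFlow (MarkovMixing.simpleWalk G) (MarkovMixing.degDist G) A) ∧
      (∀ ε : ℝ, 0 < ε → ε ≤ 1 →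
        MarkovMixing.l2MixingTime (MarkovMixing.simpleWalk G) (MarkovMixing.degDist G) ε ≤
          (⌈(m : ℝ) ^ 2 / 12 + (m : ℝ) ^ 2 / 8 * Real.log (1 / ε)⌉₊ : ℕ∞))) ∧
    (∀ A : Finset V, A.Nonempty → A ≠ Finset.univ →
      1 / (2 * (m : ℝ)) ≤
        MarkovMixing.modifiedFlow (MarkovMixing.lazyWalk G) (MarkovMixing.degDist G) A) ∧
    (∀ ε : ℝ, 0 < ε → ε ≤ 1 →
      MarkovMixing.l2MixingTime (MarkovMixing.lazyWalk G) (MarkovMixing.degDist G) ε ≤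
        (⌈(m : ℝ) ^ 2 / 3 + (m : ℝ) ^ 2 / 2 * Real.log (1 / ε)⌉₊ : ℕ∞)) := by
  subst hm
  have hm' : (MarkovMixing.numEdges G : ℝ) ≠ 0 := by exact_mod_cast hm0.ne'
  have hpos : (0 : ℝ) < MarkovMixing.numEdges G := by exact_mod_cast hm0
  refine ⟨hG.isStationary_simpleWalk hm0, hG.isStationary_lazyWalk hm0, fun hexp =>
    ⟨fun A hA hA2 => hG.le_modifiedFlow_simpleWalk hm0 hexp hA hA2, fun ε hε hε1 => ?_⟩,
    fun A hA hAu => hG.le_modifiedFlow_lazyWalk hm0 hA hAu, fun ε hε hε1 => ?_⟩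
  · have h := MarkovMixing.l2MixingTime_le (MarkovMixing.simpleWalk_nonneg G)
      (hG.sum_simpleWalk hm0) (hG.degDist_pos hm0)
      (hG.isStationary_simpleWalk hm0) (one_div_pos.2 hpos) (fun A hA hAu => ?_) hε hε1
    · convert h using 4
      field_simp
    · -- one of `A` and `Aᶜ` has mass at most `1 / 2`
      have hc := MarkovMixing.mass_compl (MarkovMixing.sum_degDist hm0) A
      rcases le_total (MarkovMixing.mass (MarkovMixing.degDist G) A) (1 / 2) with h | h
      · exact Or.inl (hG.le_modifiedFlow_simpleWalk hm0 hexp hA h)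
      · refine Or.inr (hG.le_modifiedFlow_simpleWalk hm0 hexp ?_ (by linarith))
        rwa [Finset.nonempty_iff_ne_empty, Ne, Finset.compl_eq_empty_iff]
  · have h := MarkovMixing.l2MixingTime_le (MarkovMixing.lazyWalk_nonneg G)
      (hG.sum_lazyWalk hm0) (hG.degDist_pos hm0)
      (hG.isStationary_lazyWalk hm0) (one_div_pos.2 (mul_pos two_pos hpos))
      (fun A hA hAu => Or.inl (hG.le_modifiedFlow_lazyWalk hm0 hA hAu)) hε hε1
    convert h using 4
    field_simp
    ring
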